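/- Let $n,m\ge 0$ be integers, let $\mathcal X_1,\dots,\mathcal X_n$ and $\mathcal H_1,\dots,\mathcal H_m$ be finite non-empty sets (the state spaces of the visible and of the hidden units), and put $N_i=|\mathcal X_i|$, $M_j=|\mathcal H_j|$, $\mathcal X=\prod_i\mathcal X_i$, $\mathcal H=\prod_j\mathcal H_j$, and $N_B=\prod_{i\in B}N_i$ for $B\subseteq[n]$. The restricted Boltzmann machine $\mathrm{RBM}_{n,m}$ is the set of all probability distributions on $\mathcal X$ of the form $$q(x)=\frac1Z\sum_{h\in\mathcal H}\exp\Big(\sum_{i\in[n]}\sum_{j\in[m]}W_{ij}(x_i,h_j)+\sum_{i\in[n]}b_i(x_i)+\sum_{j\in[m]}c_j(h_j)\Big),\qquad x\in\mathcal X,$$ with arbitrary real-valued functions $W_{ij}$ on $\mathcal X_i\times\mathcal H_j$, $b_i$ on $\mathcal X_i$ and $c_j$ on $\mathcal H_j$, where $Z$ is the normalising constant. For a set $\mathcal M$ of probability distributions on $\mathcal X$ let $$D_{\mathcal M}=\sup_{p}\,\inf_{q\in\mathcal M}D(p\|q),\qquad D(p\|q)=\sum_{x\in\mathcal X}p(x)\log\frac{p(x)}{q(x)},$$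 where $p$ runs over all probability distributions on $\mathcal X$ (and $D(p\|q)=\infty$ if $q(x)=0<p(x)$ for some $x$); $\log$ is the natural logarithm. (i) If $A\subseteq[n]$ is non-empty and $1+\sum_{j\in[m]}(M_j-1)\ge N_{[n]\setminus A}$, then $$D_{\mathrm{RBM}_{n,m}}\le\log\Big(\frac{N_A}{\max_{j\in A}N_j}\Big).$$ (ii) If all units are binary, that is, $N_i=2$ for all $i\in[n]$ and $M_j=2$ for all $j\in[m]$, and if $n\ge1$ and $m\le2^{n-1}-1$, then $$D_{\mathrm{RBM}_{n,m}}\le\Big(n-\lfloor\log_2(m+1)\rfloor-\frac{m+1}{2^{\lfloor\log_2(m+1)\rfloor}}\Big)\log 2.$$ -/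

import Mathlib

namespace InfoDiv

open Classical in
/-- The Kullback-Leibler divergence `D(p‖q) = ∑ₓ p(x) log (p(x) / q(x))` of two probability vectors
on a finite set, with the usual conventions: a term with `p(x) = 0` is zero, and the value is `⊤`
if `q(x) = 0 < p(x)` for some `x`. -/
noncomputable def kl {α : Type*} [Fintype α] (p q : α → ℝ) : EReal :=
  if ∀ x, q x = 0 → p x = 0 then ((∑ x, p x * Real.log (p x / q x) : ℝ) : EReal) else ⊤

/-- The divergence `D(p‖M) = inf_{q ∈ M} D(p‖q)` from `p` to the model `M`. -/
noncomputable def divFrom {α : Type*} [Fintype α] (p : α → ℝ) (M : Set (α → ℝ)) : EReal :=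
  ⨅ q ∈ M, kl p q

/-- The maximal divergence `D_M` from the model `M`: the supremum of `D(p‖M)` over all
probability vectors `p`. -/
noncomputable def maxDiv {α : Type*} [Fintype α] (M : Set (α → ℝ)) : EReal :=
  ⨆ p ∈ stdSimplex ℝ α, divFrom p M

section RBM

variable {n m : ℕ} {X : Fin n → Type*} {H : Fin m → Type*}

/-- The unnormalised joint weight of a visible state `x` and a hidden state `h`: the exponential of
the sum of a pair interaction for each edge of the complete bipartite graph between the visible
and the hidden units and of a bias for each unit. -/
noncomputable def rbmWeight (W : ∀ i j, X i → H j → ℝ) (b : ∀ i, X i → ℝ) (c : ∀ j, H j → ℝ)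
    (x : ∀ i, X i) (h : ∀ j, H j) : ℝ :=
  Real.exp (∑ i, ∑ j, W i j (x i) (h j) + ∑ i, b i (x i) + ∑ j, c j (h j))

variable [∀ i, Fintype (X i)] [∀ j, Fintype (H j)]

/-- The distribution of the visible units: the marginal of the normalised joint distribution. -/
noncomputable def rbmVisible (W : ∀ i j, X i → H j → ℝ) (b : ∀ i, X i → ℝ) (c : ∀ j, H j → ℝ)
    (x : ∀ i, X i) : ℝ :=
  (∑ h, rbmWeight W b c x h) / ∑ y, ∑ h, rbmWeight W b c y h

variable (X H) in
/-- The restricted Boltzmann machine with visible state spaces `X i` and hidden state spaces `H j`: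
the set of all visible distributions, for all real values of the parameters. -/
def RBM : Set ((∀ i, X i) → ℝ) :=
  {p | ∃ (W : ∀ i j, X i → H j → ℝ) (b : ∀ i, X i → ℝ) (c : ∀ j, H j → ℝ),
    p = rbmVisible W b c}

/-- The elements of the model are probability distributions on the visible state space. -/
theorem rbm_subset_stdSimplex [∀ i, Nonempty (X i)] [∀ j, Nonempty (H j)] :
    RBM X H ⊆ stdSimplex ℝ (∀ i, X i) := by
  rintro p ⟨W, b, c, rfl⟩
  have hpos : ∀ x, 0 < ∑ h, rbmWeight W b c x h := fun x =>
    Finset.sum_pos (fun h _ => Real.exp_pos _) Finset.univ_nonempty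
  have hZ : 0 < ∑ y, ∑ h, rbmWeight W b c y h :=
    Finset.sum_pos (fun y _ => hpos y) Finset.univ_nonempty
  refine ⟨fun x => (div_pos (hpos x) hZ).le, ?_⟩
  simp only [rbmVisible]
  rw [← Finset.sum_div, div_self hZ.ne']

end RBM

end InfoDiv

/-! ### Limits of visible weights, and divergence bounds from cylinder partitions. -/

namespace InfoDiv

section RBM

variable {n m : ℕ} {X : Fin n → Type*} {H : Fin m → Type*}

/-! Summing out `h` turns the weight into a product function times one mixture of product functions
per hidden unit. Scaling one hidden state of each unit to contribute `1`, this is `f₀ * ∏ j, (1 + ∑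
h, f_jh / f₀)`; if the `f_jh` have disjoint supports, cross terms vanish and `f₀ + ∑ f_jh` remains.
So the closure contains disjoint sums of `1 + ∑ j, (|H j| - 1)` product functions
(`add_sum_prod_mem_closure_rbmWeights`).

Given a partition into that many cylinders, take on each one the exact marginal of `p` in one free
coordinate and the uniform law in the others. This overestimates `p / C`, with `C` the number of
states of the other free coordinates, so the divergence is at most the mean of `log C`
(`divFrom_le_of_cylinders`). Bound (i) fixes the coordinates outside `A`; bound (ii) fixes `k =
⌊log₂ (m + 1)⌋` coordinates and spends the remaining `m + 1 - 2 ^ k` terms on halving the heaviest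
cylinders. -/

variable (X H) in
/-- The unnormalised visible weights of the restricted Boltzmann machine. -/
def rbmWeights [∀ j, Fintype (H j)] : Set ((∀ i, X i) → ℝ) :=
  {u | ∃ (W : ∀ i j, X i → H j → ℝ) (b : ∀ i, X i → ℝ) (c : ∀ j, H j → ℝ),
    u = fun x => ∑ h, rbmWeight W b c x h}

variable [∀ j, Fintype (H j)]

theorem rbmWeights_pos [∀ j, Nonempty (H j)] {u : (∀ i, X i) → ℝ} (hu : u ∈ rbmWeights X H)
    (x : ∀ i, X i) : 0 < u x := by
  obtain ⟨W, b, c, rfl⟩ := hu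
  exact Finset.sum_pos (fun h _ => Real.exp_pos _) Finset.univ_nonempty

/-- Products of mixtures of positive product functions, one mixture for each hidden unit, are
unnormalised visible weights. -/
theorem mem_rbmWeights_of_pos (f : ∀ i, X i → ℝ) (g : ∀ j, H j → ∀ i, X i → ℝ)
    (hf : ∀ i a, 0 < f i a) (hg : ∀ j h i a, 0 < g j h i a) :
    (fun x => (∏ i, f i (x i)) * ∏ j, ∑ h, ∏ i, g j h i (x i)) ∈ rbmWeights X H := by
  classical
  refine ⟨fun i j a h => Real.log (g j h i a), fun i a => Real.log (f i a), fun _ _ => 0, ?_⟩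
  funext x
  rw [Finset.prod_univ_sum, Finset.mul_sum, Fintype.piFinset_univ]
  refine Finset.sum_congr rfl fun h _ => ?_
  simp only [rbmWeight, Finset.sum_const_zero, add_zero, Real.exp_add, Real.exp_sum,
    Real.exp_log (hf _ _), Real.exp_log (hg _ _ _ _)]
  rw [mul_comm, Finset.prod_comm]

/-- At most one `a i` is nonzero. -/
theorem prod_one_add_eq_one_add_sum {ι : Type*} [Fintype ι] (a : ι → ℝ)
    (ha : ∀ i j, i ≠ j → a i * a j = 0) : ∏ i, (1 + a i) = 1 + ∑ i, a i := by
  classical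
  by_cases h : ∃ i, a i ≠ 0
  · obtain ⟨i, hi⟩ := h
    have h0 : ∀ j, j ≠ i → a j = 0 := fun j hj =>
      (mul_eq_zero.1 (ha j i hj)).resolve_right hi
    rw [Fintype.prod_eq_single i fun j hj => by rw [h0 j hj, add_zero],
      Fintype.sum_eq_single i h0]
  · push Not at h
    simp [h]

theorem sum_eq_add_sum_subtype_ne {ι : Type*} [Fintype ι] [DecidableEq ι] (i : ι) (f : ι → ℝ) :
    ∑ j, f j = f i + ∑ j : {j // j ≠ i}, f j := by
  rw [← Finset.add_sum_erase _ _ (Finset.mem_univ i)]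
  congr 1
  exact Finset.sum_subtype _ (by simp) _

/-- A sum of nonnegative product functions with pairwise disjoint supports, one for the visible
biases and `|H j| - 1` for each hidden unit `j`, is a limit of unnormalised visible weights. -/
theorem add_sum_prod_mem_closure_rbmWeights [∀ j, DecidableEq (H j)] (h₀ : ∀ j, H j)
    (f : Option (Σ j, {h : H j // h ≠ h₀ j}) → ∀ i, X i → ℝ) (hf : ∀ o i a, 0 ≤ f o i a)
    (hdisj : ∀ o o', o ≠ o' → ∀ x : ∀ i, X i, (∏ i, f o i (x i)) * ∏ i, f o' i (x i) = 0) :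
    (fun x => ∑ o, ∏ i, f o i (x i)) ∈ closure (rbmWeights X H) := by
  -- `ε` and `δ` keep all factors positive. The limit `δ → 0` comes first: it restores disjoint
  -- supports while the denominators stay positive.
  let g : ℝ → ℝ → ∀ j, H j → ∀ i, X i → ℝ := fun ε δ j h i a =>
    if hh : h ≠ h₀ j then (f (some ⟨j, h, hh⟩) i a + δ) / (f none i a + ε) else 1
  let G : ℝ → ℝ → (∀ i, X i) → ℝ := fun ε δ x =>
    (∏ i, (f none i (x i) + ε)) * ∏ j, ∑ h, ∏ i, g ε δ j h i (x i)
  have hG : ∀ ε > 0, ∀ δ > 0, G ε δ ∈ rbmWeights X H := by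
    intro ε hε δ hδ
    refine mem_rbmWeights_of_pos (fun i a => f none i a + ε) (g ε δ)
      (fun i a => add_pos_of_nonneg_of_pos (hf _ _ _) hε) fun j h i a => ?_
    by_cases hh : h ≠ h₀ j
    · simp only [g, dif_pos hh]
      exact div_pos (add_pos_of_nonneg_of_pos (hf _ _ _) hδ)
        (add_pos_of_nonneg_of_pos (hf _ _ _) hε)
    · simp only [g, dif_neg hh, zero_lt_one]
  have hcont : ∀ ε, Continuous (G ε) := by
    intro ε
    refine continuous_pi fun x => continuous_const.mul <| continuous_finsetProd _ fun j _ =>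
      continuous_finsetSum _ fun h _ => continuous_finsetProd _ fun i _ => ?_
    by_cases hh : h ≠ h₀ j
    · simp only [g, dif_pos hh]
      fun_prop
    · simp only [g, dif_neg hh]
      fun_prop
  have hG0 : ∀ ε > 0, G ε 0 ∈ closure (rbmWeights X H) := fun ε hε =>
    mem_closure_of_tendsto (((hcont ε).tendsto 0).mono_left nhdsWithin_le_nhds)
      (Filter.eventually_of_mem (self_mem_nhdsWithin (s := Set.Ioi (0 : ℝ)))
        fun δ hδ => hG ε hε δ hδ)
  have hval : ∀ ε > 0, G ε 0 = fun x => (∏ i, (f none i (x i) + ε)) +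
      ∑ o : Σ j, {h : H j // h ≠ h₀ j}, ∏ i, f (some o) i (x i) := by
    intro ε hε
    funext x
    have hP : 0 < ∏ i, (f none i (x i) + ε) :=
      Finset.prod_pos fun i _ => add_pos_of_nonneg_of_pos (hf _ _ _) hε
    have hsum : ∀ j, ∑ h, ∏ i, g ε 0 j h i (x i) =
        1 + (∑ h : {h : H j // h ≠ h₀ j}, ∏ i, f (some ⟨j, h⟩) i (x i)) /
          ∏ i, (f none i (x i) + ε) := by
      intro j
      rw [sum_eq_add_sum_subtype_ne (h₀ j), Finset.sum_div]
      congr 1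
      · simp [g]
      · refine Finset.sum_congr rfl fun h _ => ?_
        simp only [g, dif_pos h.2, add_zero, Finset.prod_div_distrib]
    simp only [G, hsum]
    rw [prod_one_add_eq_one_add_sum, mul_add, mul_one, ← Finset.sum_div,
      mul_div_cancel₀ _ hP.ne', Fintype.sum_sigma]
    intro j j' hj
    rw [div_mul_div_comm, Finset.sum_mul_sum, Finset.sum_eq_zero, zero_div]
    refine fun h _ => Finset.sum_eq_zero fun h' _ => hdisj _ _ ?_ x
    intro he
    exact hj (congrArg Sigma.fst (Option.some.inj he))
  have hlim : Continuous fun ε : ℝ => fun x : ∀ i, X i => (∏ i, (f none i (x i) + ε)) +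
      ∑ o : Σ j, {h : H j // h ≠ h₀ j}, ∏ i, f (some o) i (x i) := by
    fun_prop
  rw [← closure_closure]
  refine mem_closure_of_tendsto (b := nhdsWithin 0 (Set.Ioi (0 : ℝ)))
    (f := fun (ε : ℝ) (x : ∀ i, X i) => (∏ i, (f none i (x i) + ε)) +
      ∑ o : Σ j, {h : H j // h ≠ h₀ j}, ∏ i, f (some o) i (x i)) ?_ ?_
  · refine ((hlim.tendsto 0).mono_left nhdsWithin_le_nhds).trans_eq ?_
    congr 1
    funext x
    simp [Fintype.sum_option]
  · filter_upwards [self_mem_nhdsWithin] with ε hε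
    rw [← hval ε hε]
    exact hG0 ε hε

/-- A sum of at most `1 + ∑ j, (|H j| - 1)` nonnegative product functions with pairwise disjoint
supports is a limit of unnormalised visible weights. -/
theorem sum_prod_mem_closure_rbmWeights [∀ j, Nonempty (H j)] [Nonempty (Fin n)]
    {κ : Type*} [Fintype κ] (hκ : Fintype.card κ ≤ 1 + ∑ j, (Fintype.card (H j) - 1))
    (f : κ → ∀ i, X i → ℝ) (hf : ∀ k i a, 0 ≤ f k i a)
    (hdisj : ∀ k l, k ≠ l → ∀ x : ∀ i, X i, (∏ i, f k i (x i)) * ∏ i, f l i (x i) = 0) :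
    (fun x => ∑ k, ∏ i, f k i (x i)) ∈ closure (rbmWeights X H) := by
  classical
  let h₀ : ∀ j, H j := fun j => Classical.arbitrary _
  have hcard : Fintype.card κ ≤ Fintype.card (Option (Σ j, {h : H j // h ≠ h₀ j})) := by
    rw [Fintype.card_option, Fintype.card_sigma, add_comm]
    simpa [Fintype.card_subtype_compl] using hκ
  obtain ⟨e⟩ := Function.Embedding.nonempty_of_card_le hcard
  let f' : Option (Σ j, {h : H j // h ≠ h₀ j}) → ∀ i, X i → ℝ :=
    Function.extend e f fun _ _ _ => 0
  have hf' : ∀ k, f' (e k) = f k := fun k => e.injective.extend_apply f _ k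
  have hf0 : ∀ o, (¬ ∃ k, e k = o) → f' o = fun _ _ => 0 := fun o ho =>
    Function.extend_apply' f _ o ho
  -- Surplus slots hold zero factors; their product vanishes only because there is a visible unit.
  have hz : ∀ o, (¬ ∃ k, e k = o) → ∀ x : ∀ i, X i, ∏ i, f' o i (x i) = 0 := fun o ho x => by
    rw [hf0 o ho]
    exact Finset.prod_eq_zero (Finset.mem_univ (Classical.arbitrary _)) rfl
  have key := add_sum_prod_mem_closure_rbmWeights h₀ f' (fun o i a => by
    by_cases ho : ∃ k, e k = o
    · obtain ⟨k, rfl⟩ := ho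
      rw [hf']; exact hf k i a
    · rw [hf0 o ho]) (fun o o' hoo x => by
    by_cases ho : ∃ k, e k = o
    · by_cases ho' : ∃ k, e k = o'
      · obtain ⟨k, rfl⟩ := ho
        obtain ⟨l, rfl⟩ := ho'
        rw [hf', hf']
        exact hdisj k l (fun h => hoo (by rw [h])) x
      · rw [hz o' ho' x, mul_zero]
    · rw [hz o ho x, zero_mul])
  convert key using 1
  funext x
  rw [← Finset.sum_subset (Finset.subset_univ (Finset.univ.map e)) (fun o _ ho => hz o
    (fun ⟨k, hk⟩ => ho (hk ▸ Finset.mem_map_of_mem e (Finset.mem_univ k))) x), Finset.sum_map]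
  simp only [hf']

variable [∀ i, Fintype (X i)]

/-- If a limit `u` of unnormalised visible weights has total mass at most one and `p ≤ C * u`
pointwise, then the divergence from `p` to the model is at most the mean of `log C`. -/
theorem divFrom_le_of_mem_closure_rbmWeights [∀ j, Nonempty (H j)]
    {p u C : (∀ i, X i) → ℝ} (hp : p ∈ stdSimplex ℝ (∀ i, X i))
    (hu : u ∈ closure (rbmWeights X H)) (hu1 : ∑ x, u x ≤ 1) (hC : ∀ x, 0 < C x)
    (hpu : ∀ x, p x ≤ C x * u x) :
    divFrom p (RBM X H) ≤ ((∑ x, p x * Real.log (C x) : ℝ) : EReal) := by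
  classical
  obtain ⟨v, hv, hvu⟩ := mem_closure_iff_seq_limit.1 hu
  have hvx : ∀ x, Filter.Tendsto (fun k => v k x) Filter.atTop (nhds (u x)) :=
    tendsto_pi_nhds.1 hvu
  have hu0 : ∀ x, 0 ≤ u x := fun x =>
    ge_of_tendsto' (hvx x) fun k => (rbmWeights_pos (hv k) x).le
  have hle : ∀ k, divFrom p (RBM X H) ≤
      ((∑ x, p x * Real.log (p x / (v k x / ∑ y, v k y)) : ℝ) : EReal) := by
    intro k
    have hmem : (fun x => v k x / ∑ y, v k y) ∈ RBM X H := by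
      obtain ⟨W, b, c, hk⟩ := hv k
      exact ⟨W, b, c, by rw [hk]; rfl⟩
    refine (iInf₂_le _ hmem).trans (le_of_eq ?_)
    rw [kl, if_pos]
    intro x hx
    have : 0 < v k x / ∑ y, v k y := div_pos (rbmWeights_pos (hv k) x)
      (Finset.sum_pos (fun y _ => rbmWeights_pos (hv k) y) ⟨x, Finset.mem_univ x⟩)
    exact absurd hx this.ne'
  have hupos : ∀ x, p x ≠ 0 → 0 < u x := fun x hx =>
    (pos_iff_pos_of_mul_pos (lt_of_lt_of_le (lt_of_le_of_ne (hp.1 x) hx.symm) (hpu x))).1 (hC x)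
  have hZpos : ∀ x, p x ≠ 0 → 0 < ∑ y, u y := fun x hx =>
    Finset.sum_pos' (fun y _ => hu0 y) ⟨x, Finset.mem_univ x, hupos x hx⟩
  have hlim : Filter.Tendsto (fun k => ∑ x, p x * Real.log (p x / (v k x / ∑ y, v k y)))
      Filter.atTop (nhds (∑ x, p x * Real.log (p x / (u x / ∑ y, u y)))) := by
    refine tendsto_finsetSum _ fun x _ => ?_
    by_cases hx : p x = 0
    · simp [hx]
    · have hq : u x / ∑ y, u y ≠ 0 := (div_pos (hupos x hx) (hZpos x hx)).ne'
      refine Filter.Tendsto.const_mul _ (Filter.Tendsto.log ?_ (div_ne_zero hx hq))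
      exact tendsto_const_nhds.div
        ((hvx x).div (tendsto_finsetSum _ fun y _ => hvx y) (hZpos x hx).ne') hq
  refine (ge_of_tendsto' ((continuous_coe_real_ereal.tendsto _).comp hlim) hle).trans ?_
  refine EReal.coe_le_coe_iff.2 (Finset.sum_le_sum fun x _ => ?_)
  by_cases hx : p x = 0
  · simp [hx]
  · have hpx : 0 < p x := lt_of_le_of_ne (hp.1 x) (Ne.symm hx)
    have hq : 0 < u x / ∑ y, u y := div_pos (hupos x hx) (hZpos x hx)
    refine mul_le_mul_of_nonneg_left (Real.log_le_log (div_pos hpx hq) ?_) hpx.le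
    rw [div_le_iff₀ hq]
    refine (hpu x).trans (mul_le_mul_of_nonneg_left ?_ (hC x).le)
    -- As the total mass is at most one, normalising can only increase `u`.
    rw [le_div_iff₀ (hZpos x hx)]
    exact mul_le_of_le_one_right (hu0 x) hu1

/-- Let the visible states be partitioned into at most `1 + ∑ j, (|H j| - 1)` cylinder sets, the
cylinder `k` fixing the coordinates in `B k`. The divergence from `p` to the model is at most the
mean logarithm of the number of states of the free coordinates other than a chosen one. -/
theorem divFrom_le_of_cylinders [∀ i, Nonempty (X i)] [∀ j, Nonempty (H j)]
    {κ : Type*} [Fintype κ] (hκ : Fintype.card κ ≤ 1 + ∑ j, (Fintype.card (H j) - 1))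
    (π : (∀ i, X i) → κ) (B : κ → Finset (Fin n)) (s : κ → ∀ i, X i) (t : κ → Fin n)
    (ht : ∀ k, t k ∉ B k) (hπ : ∀ x k, π x = k ↔ ∀ i ∈ B k, x i = s k i)
    {p : (∀ i, X i) → ℝ} (hp : p ∈ stdSimplex ℝ (∀ i, X i)) :
    divFrom p (RBM X H) ≤
      ((∑ x, p x * Real.log (∏ i ∈ (B (π x))ᶜ.erase (t (π x)), (Fintype.card (X i) : ℝ)) : ℝ) :
        EReal) := by
  classical
  have : Nonempty (Fin n) := ⟨t (π fun i => Classical.arbitrary _)⟩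
  let C : κ → ℝ := fun k => ∏ i ∈ (B k)ᶜ.erase (t k), (Fintype.card (X i) : ℝ)
  have hC : ∀ k, 0 < C k := fun k =>
    Finset.prod_pos fun i _ => Nat.cast_pos.2 Fintype.card_pos
  let g : ∀ k, X (t k) → ℝ := fun k a => ∑ y with π y = k ∧ y (t k) = a, p y
  have hg : ∀ k a, 0 ≤ g k a := fun k a => Finset.sum_nonneg fun y _ => hp.1 y
  -- Indicators on the fixed coordinates, the marginal of `p` on `t k`, constants elsewhere; the
  -- factor at `t k` absorbs the normalisation `C k`.
  let f : κ → ∀ i, X i → ℝ := fun k i a =>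
    if h : i = t k then g k (h ▸ a) / C k
    else if i ∈ B k then (if a = s k i then 1 else 0) else 1
  have hft : ∀ k a, f k (t k) a = g k a / C k := fun k a => by simp [f]
  have hfB : ∀ k i a, i ∈ B k → f k i a = if a = s k i then 1 else 0 := fun k i a hi => by
    have : i ≠ t k := fun h => ht k (h ▸ hi)
    simp [f, this, hi]
  have hfo : ∀ k i a, i ∈ (B k)ᶜ.erase (t k) → f k i a = 1 := fun k i a hi => by
    rw [Finset.mem_erase, Finset.mem_compl] at hi
    simp [f, hi.1, hi.2]
  have hsplit : ∀ k (F : Fin n → ℝ), ∏ i, F i =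
      (∏ i ∈ B k, F i) * (F (t k) * ∏ i ∈ (B k)ᶜ.erase (t k), F i) := fun k F => by
    rw [Finset.mul_prod_erase _ _ (Finset.mem_compl.2 (ht k)), Finset.prod_mul_prod_compl]
  have hf : ∀ k i a, 0 ≤ f k i a := by
    intro k i a
    by_cases hi : i = t k
    · subst hi
      rw [hft]
      exact div_nonneg (hg _ _) (hC k).le
    · simp only [f, dif_neg hi]
      split_ifs <;> norm_num
  have hself : ∀ k x, π x = k → ∏ i, f k i (x i) = g k (x (t k)) / C k := by
    intro k x hx
    rw [hsplit k, Finset.prod_congr rfl fun i hi => hfo k i (x i) hi, hft,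
      Finset.prod_eq_one fun i hi => by rw [hfB k i _ hi, if_pos ((hπ x k).1 hx i hi)]]
    simp
  have hother : ∀ k x, π x ≠ k → ∏ i, f k i (x i) = 0 := by
    intro k x hx
    rw [Ne, hπ] at hx
    push Not at hx
    obtain ⟨i, hi, hne⟩ := hx
    exact Finset.prod_eq_zero (Finset.mem_univ i) (by rw [hfB k i _ hi, if_neg hne])
  have hu := sum_prod_mem_closure_rbmWeights (H := H) hκ f hf fun k l hkl x => by
    by_cases hk : π x = k
    · rw [hother l x (fun h => hkl (hk.symm.trans h)), mul_zero]
    · rw [hother k x hk, zero_mul]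
  refine divFrom_le_of_mem_closure_rbmWeights (C := fun x => C (π x)) hp hu ?_
    (fun x => hC _) fun x => ?_
  · rw [Finset.sum_comm]
    calc ∑ k, ∑ x : ∀ i, X i, ∏ i, f k i (x i) = ∑ k, ∑ y with π y = k, p y := by
          refine Finset.sum_congr rfl fun k _ => ?_
          have hB : ∏ i ∈ B k, ∑ a, f k i a = 1 := Finset.prod_eq_one fun i hi => by
            simp only [hfB k i _ hi]
            simp
          have hr : ∏ i ∈ (B k)ᶜ.erase (t k), ∑ a, f k i a = C k :=
            Finset.prod_congr rfl fun i hi => by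
              simp only [hfo k i _ hi]
              simp
          have hps : ∑ x : ∀ i, X i, ∏ i, f k i (x i) = ∏ i, ∑ a, f k i a := by
            rw [Finset.prod_univ_sum, Fintype.piFinset_univ]
          rw [hps, hsplit k, hB, hr]
          simp only [hft]
          rw [← Finset.sum_div, one_mul, div_mul_cancel₀ _ (hC k).ne',
            ← Finset.sum_fiberwise (Finset.univ.filter fun y => π y = k) (fun y => y (t k)) p]
          simp only [g, Finset.filter_filter]
      _ = ∑ y, p y := Finset.sum_fiberwise _ _ _
      _ ≤ 1 := hp.2.le
  · rw [Fintype.sum_eq_single (π x) fun k hk => hother k x (Ne.symm hk), hself _ x rfl,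
      mul_div_cancel₀ _ (hC _).ne']
    -- `p x` is one of the summands of the marginal at `x (t k)`.
    exact Finset.single_le_sum (f := p) (fun y _ => hp.1 y) (by simp)

end RBM

end InfoDiv

/-! ### The two bounds. -/

namespace InfoDiv

/-- Some `r`-element subset of `S` carries at least the fraction `r / |S|` of the total weight. -/
theorem exists_subset_card_eq_mul_sum_le {α : Type*} (w : α → ℝ) (r : ℕ) (S : Finset α)
    (hr : r ≤ S.card) :
    ∃ R ⊆ S, R.card = r ∧ (r : ℝ) * ∑ a ∈ S, w a ≤ S.card * ∑ a ∈ R, w a := by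
  classical
  induction hd : S.card - r generalizing S with
  | zero => exact ⟨S, subset_rfl, by omega, by rw [show S.card = r by omega]⟩
  | succ d ih =>
    -- Discarding a lightest element does not lower the average weight.
    obtain ⟨a, ha, hmin⟩ := S.exists_min_image w (Finset.card_pos.1 (by omega))
    have hcard := Finset.card_erase_add_one ha
    obtain ⟨R, hR, hRr, hle⟩ := ih (S.erase a) (by omega) (by omega)
    refine ⟨R, hR.trans (Finset.erase_subset _ _), hRr, ?_⟩
    have h1 : (r : ℝ) * w a ≤ ∑ b ∈ R, w b := by
      rw [← hRr, ← nsmul_eq_mul]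
      exact Finset.card_nsmul_le_sum _ _ _ fun b hb => hmin b (Finset.erase_subset _ _ (hR hb))
    rw [← Finset.sum_erase_add _ _ ha, ← hcard]
    push_cast
    linarith

section RBM

variable {n m : ℕ} {X : Fin n → Type*} {H : Fin m → Type*}
  [∀ i, Fintype (X i)] [∀ i, Nonempty (X i)] [∀ j, Fintype (H j)] [∀ j, Nonempty (H j)]

/-- One cylinder per state of the units outside `A`; the exact marginal is spent on a unit of `A`
with the most states. -/
theorem maxDiv_RBM_le_log_div (A : Finset (Fin n)) (hA : A.Nonempty)
    (h : ∏ i ∈ Aᶜ, Fintype.card (X i) ≤ 1 + ∑ j, (Fintype.card (H j) - 1)) :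
    maxDiv (RBM X H) ≤ ((Real.log ((∏ i ∈ A, (Fintype.card (X i) : ℝ)) /
      A.sup' hA (fun j => (Fintype.card (X j) : ℝ))) : ℝ) : EReal) := by
  classical
  obtain ⟨j₀, hj₀, hsup⟩ := A.exists_mem_eq_sup' hA fun j => (Fintype.card (X j) : ℝ)
  have hN : (Fintype.card (X j₀) : ℝ) ≠ 0 := Nat.cast_ne_zero.2 Fintype.card_ne_zero
  have hval : ∏ i ∈ Aᶜᶜ.erase j₀, (Fintype.card (X i) : ℝ) =
      (∏ i ∈ A, (Fintype.card (X i) : ℝ)) / A.sup' hA fun j => (Fintype.card (X j) : ℝ) := by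
    rw [compl_compl, hsup, eq_div_iff hN, Finset.prod_erase_mul _ _ hj₀]
  have hκ : Fintype.card (∀ i : {i // i ∈ Aᶜ}, X i) ≤ 1 + ∑ j, (Fintype.card (H j) - 1) := by
    rw [Fintype.card_pi]
    exact (Finset.prod_coe_sort Aᶜ fun i => Fintype.card (X i)).trans_le h
  refine iSup₂_le fun p hp => ?_
  refine (divFrom_le_of_cylinders hκ (fun x i => x i) (fun _ => Aᶜ)
    (fun k i => if hi : i ∈ Aᶜ then k ⟨i, hi⟩ else Classical.arbitrary _) (fun _ => j₀)
    (fun _ => by simpa using hj₀) (fun x k => ?_) hp).trans (le_of_eq ?_)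
  · constructor
    · rintro rfl i hi
      simp only [dif_pos hi]
    · intro hx
      funext ⟨i, hi⟩
      simpa only [dif_pos hi] using hx i hi
  · simp only [hval]
    rw [← Finset.sum_mul, hp.2, one_mul]

/-- Of the `2 ^ k` cylinders fixing coordinates `0, …, k - 1`, `r` with mass at least `r / 2 ^ k`
are split along coordinate `k`. Splitting lowers `log C` by `log 2` there; `k + 1 < n` leaves a free
coordinate for the marginal. -/
theorem maxDiv_RBM_binary_le (hX : ∀ i, Fintype.card (X i) = 2)
    (hH : ∀ j, Fintype.card (H j) = 2) (k r : ℕ) (hk : k + 1 < n) (hr : r ≤ 2 ^ k)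
    (hm : 2 ^ k + r ≤ m + 1) :
    maxDiv (RBM X H) ≤ ((((n : ℝ) - k - 1 - r / 2 ^ k) * Real.log 2 : ℝ) : EReal) := by
  classical
  refine iSup₂_le fun p hp => ?_
  let P := ∀ i : {i : Fin n // i.1 < k}, X i
  let ρ : (∀ i, X i) → P := fun x i => x i
  let i₀ : Fin n := ⟨k, by omega⟩
  let i₁ : Fin n := ⟨k + 1, hk⟩
  have hfilter : ∀ l ≤ n, (Finset.univ.filter fun i : Fin n => i.1 < l).card = l := by
    intro l hl
    rw [Fin.card_filter_val_lt, min_eq_right hl]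
  have hPcard : Fintype.card P = 2 ^ k := by
    rw [Fintype.card_pi]
    simp only [hX, Finset.prod_const]
    rw [Finset.card_univ, Fintype.card_subtype, hfilter k (by omega)]
  obtain ⟨R, -, hRr, hRle⟩ := exists_subset_card_eq_mul_sum_le
    (fun s : P => ∑ x with ρ x = s, p x) r Finset.univ (by rwa [Finset.card_univ, hPcard])
  rw [Finset.sum_fiberwise, hp.2, mul_one, Finset.card_univ, hPcard] at hRle
  have hRle : (r : ℝ) / 2 ^ k ≤ ∑ x with ρ x ∈ R, p x := by
    rw [div_le_iff₀' (by positivity)]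
    refine hRle.trans (le_of_eq ?_)
    push_cast
    rw [← Finset.sum_fiberwise_of_maps_to (s := Finset.univ.filter fun x => ρ x ∈ R) (t := R)
      (g := ρ) (fun x hx => (Finset.mem_filter.1 hx).2) p]
    congr 1
    refine Finset.sum_congr rfl fun s hs => Finset.sum_congr ?_ fun _ _ => rfl
    ext x
    simp only [Finset.mem_filter, Finset.mem_univ, true_and]
    exact ⟨fun h => ⟨h ▸ hs, h⟩, fun h => h.2⟩
  let κ := {s : P // s ∉ R} ⊕ ({s : P // s ∈ R} × X i₀)
  have hκ : Fintype.card κ ≤ 1 + ∑ j, (Fintype.card (H j) - 1) := by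
    have h1 : Fintype.card κ = (2 ^ k - r) + r * 2 := by
      rw [Fintype.card_sum, Fintype.card_prod, hX, Fintype.card_subtype_compl, Fintype.card_coe,
        hPcard, hRr]
    rw [h1]
    simp only [hH, Finset.sum_const, Finset.card_univ, Fintype.card_fin, smul_eq_mul]
    omega
  let π : (∀ i, X i) → κ := fun x =>
    if h : ρ x ∈ R then Sum.inr (⟨ρ x, h⟩, x i₀) else Sum.inl ⟨ρ x, h⟩
  let B : κ → Finset (Fin n) :=
    Sum.elim (fun _ => Finset.univ.filter fun i => i.1 < k)
      (fun _ => Finset.univ.filter fun i => i.1 < k + 1)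
  let e : P → ∀ i, X i := fun s i => if h : i.1 < k then s ⟨i, h⟩ else Classical.arbitrary _
  let s : κ → ∀ i, X i := Sum.elim (fun u => e u) fun u => Function.update (e u.1) i₀ u.2
  let t : κ → Fin n := Sum.elim (fun _ => i₀) fun _ => i₁
  have ht : ∀ u, t u ∉ B u := by
    rintro (u | u) <;> simp [t, B, i₀, i₁]
  have hρ : ∀ x (u : P), ρ x = u ↔ ∀ i : Fin n, i.1 < k → x i = e u i := by
    intro x u
    constructor
    · rintro rfl i hi
      simp only [e, dif_pos hi, ρ]
    · intro hx
      funext ⟨i, hi⟩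
      simpa only [e, dif_pos hi] using hx i hi
  have hπ : ∀ x u, π x = u ↔ ∀ i ∈ B u, x i = s u i := by
    rintro x (u | ⟨u, a⟩)
    · have h1 : π x = Sum.inl u ↔ ρ x = u := by
        by_cases h : ρ x ∈ R
        · simp only [π, dif_pos h, reduceCtorEq, false_iff]
          exact fun hu => u.2 (hu ▸ h)
        · simp only [π, dif_neg h]
          exact Sum.inl_injective.eq_iff.trans Subtype.ext_iff
      rw [h1, hρ]
      simp [B, s]
    · have h1 : π x = Sum.inr (u, a) ↔ ρ x = u ∧ x i₀ = a := by
        by_cases h : ρ x ∈ R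
        · simp only [π, dif_pos h]
          exact Sum.inr_injective.eq_iff.trans
            (Prod.ext_iff.trans (and_congr_left' Subtype.ext_iff))
        · simp only [π, dif_neg h, reduceCtorEq, false_iff]
          exact fun hu => h (hu.1 ▸ u.2)
      rw [h1, hρ]
      simp only [B, s, Sum.elim_inr, Finset.mem_filter, Finset.mem_univ, true_and]
      constructor
      · rintro ⟨hx, rfl⟩ i hi
        by_cases hi₀ : i = i₀
        · subst hi₀
          rw [Function.update_self]
        · rw [Function.update_of_ne hi₀]
          have : i.1 ≠ k := fun h => hi₀ (Fin.ext h)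
          exact hx i (by omega)
      · intro hx
        refine ⟨fun i hi => ?_, ?_⟩
        · have hi₀ : i ≠ i₀ := fun h => by rw [h] at hi; exact lt_irrefl _ hi
          rw [hx i (by omega), Function.update_of_ne hi₀]
        · rw [hx i₀ (Nat.lt_succ_self k), Function.update_self]
  have hlog : ∀ x, Real.log (∏ i ∈ (B (π x))ᶜ.erase (t (π x)), (Fintype.card (X i) : ℝ)) =
      ((n : ℝ) - k - 1 - if ρ x ∈ R then 1 else 0) * Real.log 2 := by
    intro x
    simp only [hX, Finset.prod_const, Nat.cast_ofNat, Real.log_pow]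
    rw [Finset.card_erase_of_mem (Finset.mem_compl.2 (ht _)), Finset.card_compl,
      Fintype.card_fin]
    congr 1
    by_cases h : ρ x ∈ R
    · rw [show B (π x) = Finset.univ.filter fun i : Fin n => i.1 < k + 1 by
        simp only [π, dif_pos h, B, Sum.elim_inr], hfilter _ (by omega), if_pos h,
        Nat.cast_sub (by omega), Nat.cast_sub (by omega)]
      push_cast
      ring
    · rw [show B (π x) = Finset.univ.filter fun i : Fin n => i.1 < k by
        simp only [π, dif_neg h, B, Sum.elim_inl], hfilter _ (by omega), if_neg h,
        Nat.cast_sub (by omega), Nat.cast_sub (by omega)]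
      push_cast
      ring
  refine (divFrom_le_of_cylinders hκ π B s t ht hπ hp).trans (EReal.coe_le_coe_iff.2 ?_)
  simp only [hlog]
  have hsum : ∑ x, p x * (((n : ℝ) - k - 1 - if ρ x ∈ R then 1 else 0) * Real.log 2) =
      ((n : ℝ) - k - 1 - ∑ x with ρ x ∈ R, p x) * Real.log 2 := by
    simp only [← mul_assoc]
    rw [← Finset.sum_mul]
    simp only [mul_sub, Finset.sum_sub_distrib, ← Finset.sum_mul, hp.2, mul_ite, mul_one,
      mul_zero, one_mul, Finset.sum_filter]
  rw [hsum]
  exact mul_le_mul_of_nonneg_right (by linarith) (Real.log_nonneg (by norm_num))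

end RBM

end InfoDiv

theorem mainTheorem2 (n m : ℕ)
    (X : Fin n → Type*) [∀ i, Fintype (X i)] [∀ i, Nonempty (X i)]
    (H : Fin m → Type*) [∀ j, Fintype (H j)] [∀ j, Nonempty (H j)] :
    (∀ (A : Finset (Fin n)) (hA : A.Nonempty),
      ∏ i ∈ Aᶜ, Fintype.card (X i) ≤ 1 + ∑ j, (Fintype.card (H j) - 1) →
      InfoDiv.maxDiv (InfoDiv.RBM X H) ≤
        ((Real.log ((∏ i ∈ A, (Fintype.card (X i) : ℝ)) /
          A.sup' hA (fun j => (Fintype.card (X j) : ℝ))) : ℝ) : EReal)) ∧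
    ((∀ i, Fintype.card (X i) = 2) → (∀ j, Fintype.card (H j) = 2) →
      1 ≤ n → m ≤ 2 ^ (n - 1) - 1 →
      InfoDiv.maxDiv (InfoDiv.RBM X H) ≤
        ((((n : ℝ) - (Nat.log 2 (m + 1) : ℝ) - ((m : ℝ) + 1) / 2 ^ Nat.log 2 (m + 1)) *
          Real.log 2 : ℝ) : EReal)) := by
  refine ⟨InfoDiv.maxDiv_RBM_le_log_div, fun hX hH hn hm => ?_⟩
  have hpow : 0 < 2 ^ (n - 1) := by positivity
  have hle : 2 ^ Nat.log 2 (m + 1) ≤ m + 1 := Nat.pow_log_le_self 2 (Nat.succ_ne_zero m)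
  have hlt : m + 1 < 2 ^ (Nat.log 2 (m + 1) + 1) := Nat.lt_pow_succ_log_self one_lt_two _
  have hkn : Nat.log 2 (m + 1) ≤ n - 1 :=
    (Nat.pow_le_pow_iff_right one_lt_two).1 (hle.trans (by omega))
  generalize Nat.log 2 (m + 1) = k at hle hlt hkn ⊢
  rw [pow_succ] at hlt
  rcases hkn.lt_or_eq with hk | rfl
  -- `m + 1 < 2 ^ (k + 1)` makes `r = m + 1 - 2 ^ k` at most `2 ^ k`.
  · refine (InfoDiv.maxDiv_RBM_binary_le hX hH k (m + 1 - 2 ^ k) (by omega) (by omega)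
      (by omega)).trans (le_of_eq (congrArg Real.toEReal ?_))
    rw [Nat.cast_sub hle]
    push_cast
    rw [sub_div, div_self (by positivity)]
    congr 1
    ring
  -- Here `k = n - 1` forces `m + 1 = 2 ^ (n - 1)`, and bound (i) for a single unit gives `log 1 =
  -- 0`.
  · have hm' : (m : ℝ) + 1 = 2 ^ (n - 1) := by
      exact_mod_cast (show m + 1 = 2 ^ (n - 1) by omega)
    refine (InfoDiv.maxDiv_RBM_le_log_div {(⟨0, hn⟩ : Fin n)} (Finset.singleton_nonempty _)
      ?_).trans (le_of_eq ?_)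
    · simp only [hX, hH, Finset.prod_const, Finset.card_compl, Finset.card_singleton,
        Fintype.card_fin, Finset.sum_const, Finset.card_univ, smul_eq_mul]
      omega
    · rw [hm', div_self (by positivity), Nat.cast_sub hn]
      simp [hX]
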